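/- Let $n\ge 3$ be an integer and let $p$ be a real number. Call a function $u:\mathbb R^n\to\mathbb R$ a solution of the Matukuma equation with exponent $p$ if $u\in C^2(\mathbb R^n)$ and $$-\Delta u(x)=\frac{1}{1+|x|^2}\,u(x)^p \quad\text{and}\quad u(x)>0 \qquad\text{for all } x\in\mathbb R^n .$$ (i) If $1\le p\le \frac{n}{n-2}$, then every such solution $u$ is radially symmetric about the origin, that is, $u(x)=u(y)$ whenever $|x|=|y|$. (ii) If $0\le p<1$, then there is no such solution. In particular both assertions hold for $C^\infty$ solutions. -/

import Mathlib

/-- `u : ℝⁿ → ℝ` is a (classical, entire) solution of the Matukuma equation with exponent `p`: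
`u` is of class `C²`, `u > 0` and `-Δu = u ^ p / (1 + |x|²)` everywhere on `ℝⁿ`. -/
structure IsMatukumaSolution (n : ℕ) (p : ℝ) (u : EuclideanSpace ℝ (Fin n) → ℝ) : Prop where
  contDiff : ContDiff ℝ 2 u
  pos : ∀ x, 0 < u x
  eq : ∀ x, -(Laplacian.laplacian u x) = 1 / (1 + ‖x‖ ^ 2) * (u x) ^ p

/-- `u : ℝⁿ → ℝ` is radially symmetric about the origin: it depends on `|x|` only. -/
def IsRadiallySymmetric {n : ℕ} (u : EuclideanSpace ℝ (Fin n) → ℝ) : Prop :=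
  ∀ x y : EuclideanSpace ℝ (Fin n), ‖x‖ = ‖y‖ → u x = u y

/-! Symmetry is proved by moving spheres through the origin. For a unit vector `e` and `s > 0`, put
`x = s (e + z)`. The sphere with centre `s e` and radius `s`, which contains the origin, becomes
`|z| = 1`. Let `V` be the rescaled solution and `W` its Kelvin transform, so that `V = W` on the
unit sphere. The goal is `V ≤ W` in the punctured unit ball for every `s`. As `s → ∞` the balls
exhaust the half-space `⟪x, e⟫ > 0` and the inversions tend to the reflection in the hyperplane
orthogonal to `e`. This gives `u x ≤ u (reflected x)`, and since `e` is arbitrary, `u` is radial.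

The driving fact is `laplacian_kelvinTransform_lt`: because the sphere contains the origin and `p ≤
n / (n - 2)`, `W` is a strict supersolution of the equation for `V` inside the ball. The set of
admissible `s` is then nonempty, open and closed in `(0, ∞)`. The strictness rules out interior
contact by a second-derivative test, so no strong maximum principle is needed. The boundary `|z| =
1`, where the two functions touch, is handled in a thin shell carrying an explicit positive
supersolution, instead of Hopf's lemma. The singularity of `W` at `z = 0` is harmless because
superharmonic functions bounded below ignore points when `n ≥ 3`.

For `0 ≤ p < 1`, concavity gives `Δ (u ^ (1 - p)) ≤ -(1 - p) / (1 + |x|²)`. A small multiple of `log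
(1 + |x|²)` can be added without losing the negative sign. The sum tends to infinity, so it has a
minimum, which contradicts the strict superharmonicity. -/

/-! ### Second derivatives along lines and the Laplacian at a minimum. -/

open Filter Topology Laplacian in
/-- The Laplacian computed from second derivatives along the lines of an orthonormal basis. -/
theorem laplacian_eq_sum_of_hasDerivAt_line {E : Type*} [NormedAddCommGroup E]
    [InnerProductSpace ℝ E] [FiniteDimensional ℝ E] {ι : Type*} [Fintype ι]
    (b : OrthonormalBasis ι ℝ E) {f : E → ℝ} {x : E} (hf : ContDiffAt ℝ 2 f x)
    {g' : ι → ℝ → ℝ} {g'' : ι → ℝ}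
    (h1 : ∀ i, ∀ᶠ t in 𝓝 (0 : ℝ), HasDerivAt (fun t => f (x + t • b i)) (g' i t) t)
    (h2 : ∀ i, HasDerivAt (g' i) (g'' i) 0) :
    Δ f x = ∑ i, g'' i := by
  rw [InnerProductSpace.laplacian_eq_iteratedFDeriv_orthonormalBasis f b]
  refine Finset.sum_congr rfl fun i _ => ?_
  rw [iteratedFDeriv_two_apply]
  have hline : ∀ t : ℝ, HasDerivAt (fun t : ℝ => x + t • b i) (b i) t := fun t => by
    simpa using ((hasDerivAt_id t).smul_const (b i)).const_add x
  have hcont : Tendsto (fun t : ℝ => x + t • b i) (𝓝 0) (𝓝 x) := by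
    simpa using (hline 0).continuousAt.tendsto
  have hd : ∀ᶠ y in 𝓝 x, DifferentiableAt ℝ f y := by
    filter_upwards [hf.eventually (by simp)] with y hy using hy.differentiableAt (by simp)
  have hd2 : HasFDerivAt (fderiv ℝ f) (fderiv ℝ (fderiv ℝ f) x) (x + (0 : ℝ) • b i) := by
    simpa using ((hf.fderiv_right (m := 1) (by norm_num)).differentiableAt
      (by simp)).hasFDerivAt
  have e1 : g' i =ᶠ[𝓝 0] fun t => fderiv ℝ f (x + t • b i) (b i) := by
    filter_upwards [h1 i, hcont.eventually hd] with t ht1 ht2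
    exact ht1.unique (ht2.hasFDerivAt.comp_hasDerivAt t (hline t))
  have e2 : HasDerivAt (fun t : ℝ => fderiv ℝ f (x + t • b i) (b i))
      (fderiv ℝ (fderiv ℝ f) x (b i) (b i)) 0 := by
    have h3 : HasDerivAt (fun t : ℝ => fderiv ℝ f (x + t • b i))
        (fderiv ℝ (fderiv ℝ f) x (b i)) 0 := hd2.comp_hasDerivAt (0 : ℝ) (hline 0)
    exact (ContinuousLinearMap.apply ℝ ℝ (b i)).hasFDerivAt.comp_hasDerivAt (0 : ℝ) h3
  simpa using (e2.congr_of_eventuallyEq e1).unique (h2 i)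

open Filter Topology in
/-- First derivative of a `C²` function along a line. -/
theorem ContDiffAt.eventually_hasDerivAt_line {E : Type*} [NormedAddCommGroup E]
    [NormedSpace ℝ E] {f : E → ℝ} {x : E} (hf : ContDiffAt ℝ 2 f x) (h : E) :
    ∀ᶠ t in 𝓝 (0 : ℝ), HasDerivAt (fun t : ℝ => f (x + t • h)) (fderiv ℝ f (x + t • h) h) t := by
  have hline : ∀ t : ℝ, HasDerivAt (fun t : ℝ => x + t • h) h t := fun t => by
    simpa using ((hasDerivAt_id t).smul_const h).const_add x
  have hcont : Tendsto (fun t : ℝ => x + t • h) (𝓝 0) (𝓝 x) := by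
    simpa using (hline 0).continuousAt.tendsto
  have hd : ∀ᶠ y in 𝓝 x, DifferentiableAt ℝ f y := by
    filter_upwards [hf.eventually (by simp)] with y hy using hy.differentiableAt (by simp)
  filter_upwards [hcont.eventually hd] with t ht
  exact ht.hasFDerivAt.comp_hasDerivAt t (hline t)

/-- Second derivative of a `C²` function along a line. -/
theorem ContDiffAt.hasDerivAt_fderiv_line {E : Type*} [NormedAddCommGroup E]
    [NormedSpace ℝ E] {f : E → ℝ} {x : E} (hf : ContDiffAt ℝ 2 f x) (h : E) :
    HasDerivAt (fun t : ℝ => fderiv ℝ f (x + t • h) h)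
      (fderiv ℝ (fderiv ℝ f) x h h) 0 := by
  have hline : HasDerivAt (fun t : ℝ => x + t • h) h 0 := by
    simpa using ((hasDerivAt_id (0 : ℝ)).smul_const h).const_add x
  have hd2 : HasFDerivAt (fderiv ℝ f) (fderiv ℝ (fderiv ℝ f) x) (x + (0 : ℝ) • h) := by
    simpa using ((hf.fderiv_right (m := 1) (by norm_num)).differentiableAt
      (by simp)).hasFDerivAt
  have h3 : HasDerivAt (fun t : ℝ => fderiv ℝ f (x + t • h))
      (fderiv ℝ (fderiv ℝ f) x h) 0 := hd2.comp_hasDerivAt (0 : ℝ) hline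
  exact (ContinuousLinearMap.apply ℝ ℝ h).hasFDerivAt.comp_hasDerivAt (0 : ℝ) h3

open Laplacian in
theorem laplacian_eq_sum_fderiv_fderiv {E : Type*} [NormedAddCommGroup E]
    [InnerProductSpace ℝ E] [FiniteDimensional ℝ E] {ι : Type*} [Fintype ι]
    (b : OrthonormalBasis ι ℝ E) (f : E → ℝ) (x : E) :
    Δ f x = ∑ i, fderiv ℝ (fderiv ℝ f) x (b i) (b i) := by
  rw [InnerProductSpace.laplacian_eq_iteratedFDeriv_orthonormalBasis f b]
  simp [iteratedFDeriv_two_apply]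

open Filter Topology in
/-- The second derivative is nonnegative at a local minimum. -/
theorem IsLocalMin.second_deriv_nonneg {f f' : ℝ → ℝ} {f'' x : ℝ} (hmin : IsLocalMin f x)
    (h1 : ∀ᶠ t in 𝓝 x, HasDerivAt f (f' t) t) (h2 : HasDerivAt f' f'' x) : 0 ≤ f'' := by
  by_contra! hneg
  have e : deriv f =ᶠ[𝓝 x] f' := h1.mono fun t ht => ht.deriv
  have hdd : deriv (deriv f) x = f'' := by rw [e.deriv_eq, h2.deriv]
  -- With `f'' < 0` the point is a local maximum as well, so `f` is locally constant, which forces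
  -- `f'' = 0`.
  have hmax : IsLocalMax f x := isLocalMax_of_deriv_deriv_neg (by rw [hdd]; exact hneg)
    hmin.deriv_eq_zero h1.self_of_nhds.continuousAt
  have hconst : f =ᶠ[𝓝 x] fun _ => f x := by
    filter_upwards [hmin, hmax] with y h1 h2 using le_antisymm h2 h1
  have : deriv (deriv f) x = 0 := by
    have e1 : deriv f =ᶠ[𝓝 x] fun _ => 0 := by
      simpa using hconst.deriv
    rw [e1.deriv_eq]; simp
  linarith

open Filter Topology Laplacian in
/-- The Laplacian is nonnegative at a local minimum. -/
theorem IsLocalMin.laplacian_nonneg {E : Type*} [NormedAddCommGroup E]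
    [InnerProductSpace ℝ E] [FiniteDimensional ℝ E] {f : E → ℝ} {x : E} (hmin : IsLocalMin f x)
    (hf : ContDiffAt ℝ 2 f x) : 0 ≤ Δ f x := by
  rw [laplacian_eq_sum_fderiv_fderiv (stdOrthonormalBasis ℝ E)]
  refine Finset.sum_nonneg fun i _ => ?_
  set h := stdOrthonormalBasis ℝ E i
  have hcont : Tendsto (fun t : ℝ => x + t • h) (𝓝 0) (𝓝 x) := by
    have : Continuous (fun t : ℝ => x + t • h) := by fun_prop
    simpa using this.tendsto 0
  refine IsLocalMin.second_deriv_nonneg (f := fun t : ℝ => f (x + t • h)) ?_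
    (hf.eventually_hasDerivAt_line h) (hf.hasDerivAt_fderiv_line h)
  have := hcont.eventually hmin
  simpa [IsLocalMin, IsMinFilter] using this

/-! ### The Kelvin transform and its Laplacian. -/

/-- The Kelvin transform with respect to the unit sphere. -/
noncomputable def kelvinTransform {E : Type*} [NormedAddCommGroup E] [InnerProductSpace ℝ E]
    (v : E → ℝ) (z : E) : ℝ :=
  (‖z‖ ^ 2) ^ (1 - (Module.finrank ℝ E : ℝ) / 2) * v ((‖z‖ ^ 2)⁻¹ • z)

theorem ContDiff.kelvinTransform {E : Type*} [NormedAddCommGroup E] [InnerProductSpace ℝ E]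
    {v : E → ℝ} (hv : ContDiff ℝ 2 v) {z : E} (hz : z ≠ 0) :
    ContDiffAt ℝ 2 (kelvinTransform v) z := by
  have hq : ContDiffAt ℝ 2 (fun z : E => ‖z‖ ^ 2) z := (contDiff_norm_sq ℝ).contDiffAt
  have hq0 : ‖z‖ ^ 2 ≠ 0 := by positivity
  exact (hq.rpow_const_of_ne hq0).mul (hv.contDiffAt.comp z ((hq.inv hq0).smul contDiffAt_id))

open Filter Topology Laplacian RealInnerProductSpace in
-- The exponent `1 - n / 2` of `|z|²` makes the prefactor harmonic and cancels every first-order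
-- term. The inversion is conformal, so of the second-order terms only a multiple of the Laplacian
-- survives.
theorem laplacian_kelvinTransform {E : Type*} [NormedAddCommGroup E] [InnerProductSpace ℝ E]
    [FiniteDimensional ℝ E] {v : E → ℝ} (hv : ContDiff ℝ 2 v) {z : E} (hz : z ≠ 0) :
    Δ (kelvinTransform v) z =
      (‖z‖ ^ 2) ^ (-1 - (Module.finrank ℝ E : ℝ) / 2) * Δ v ((‖z‖ ^ 2)⁻¹ • z) := by
  set b := stdOrthonormalBasis ℝ E with hb
  set α : ℝ := 1 - (Module.finrank ℝ E : ℝ) / 2 with hα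
  set Q : ℝ := ‖z‖ ^ 2 with hQ
  have hQ0 : 0 < Q := by positivity
  set y₀ := Q⁻¹ • z with hy₀
  set L := fderiv ℝ v y₀ with hL
  set B := fderiv ℝ (fderiv ℝ v) y₀ with hB
  let q : _ → ℝ → ℝ := fun i t => Q + 2 * t * ⟪z, b i⟫ + t ^ 2
  let q' : _ → ℝ → ℝ := fun i t => 2 * ⟪z, b i⟫ + 2 * t
  let y : _ → ℝ → E := fun i t => (q i t)⁻¹ • (z + t • b i)
  let y' : _ → ℝ → E := fun i t =>
    (q i t)⁻¹ • b i - ((q i t)⁻¹ ^ 2 * q' i t) • (z + t • b i)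
  have hq : ∀ i t, HasDerivAt (q i) (q' i t) t := fun i t => by
    have := (((hasDerivAt_id t).const_mul 2).mul_const ⟪z, b i⟫).const_add Q |>.add
      ((hasDerivAt_id t).pow 2)
    refine HasDerivAt.congr_deriv (f := q i) this ?_
    simp [q']
  have hqnorm : ∀ i t, ‖z + t • b i‖ ^ 2 = q i t := fun i t => by
    rw [norm_add_sq_real, norm_smul, inner_smul_right, b.norm_eq_one i]
    simp [q]; ring
  have hqpos : ∀ i, ∀ᶠ t in 𝓝 (0 : ℝ), 0 < q i t := fun i =>
    (hq i 0).continuousAt.eventually (lt_mem_nhds (by simpa [q] using hQ0))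
  have hlin : ∀ i t, HasDerivAt (fun t : ℝ => z + t • b i) (b i) t := fun i t => by
    simpa using ((hasDerivAt_id t).smul_const (b i)).const_add z
  have hqinv : ∀ i t, 0 < q i t →
      HasDerivAt (fun t => (q i t)⁻¹) (-((q i t)⁻¹ ^ 2 * q' i t)) t := fun i t ht => by
    refine HasDerivAt.congr_deriv ((hq i t).inv ht.ne') ?_
    field_simp
  have hy : ∀ i t, 0 < q i t → HasDerivAt (y i) (y' i t) t := fun i t ht => by
    refine HasDerivAt.congr_deriv (f := y i) ((hqinv i t ht).smul (hlin i t)) ?_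
    simp only [y', neg_smul]; abel
  have hv1 : Differentiable ℝ v := hv.differentiable (by norm_num)
  have hv2 : Differentiable ℝ (fderiv ℝ v) :=
    (hv.fderiv_right (m := 1) (by norm_num)).differentiable (by simp)
  have hy0 : ∀ i, y i 0 = y₀ := fun i => by simp [y, q, hy₀]
  have hq0 : ∀ i, q i 0 = Q := fun i => by simp [q]
  have hq'0 : ∀ i, q' i 0 = 2 * ⟪z, b i⟫ := fun i => by simp [q']
  have hrpow : ∀ (β : ℝ) i t, 0 < q i t →
      HasDerivAt (fun t => (q i t) ^ β) (q' i t * β * q i t ^ (β - 1)) t := fun β i t ht =>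
    (hq i t).rpow_const (Or.inl ht.ne')
  have main := laplacian_eq_sum_of_hasDerivAt_line b (f := kelvinTransform v) (x := z)
    (hv.kelvinTransform hz)
    (g' := fun i t => (q' i t * α * q i t ^ (α - 1)) * v (y i t) +
      (q i t) ^ α * fderiv ℝ v (y i t) (y' i t))
    (g'' := fun i => (4 * α * (α - 1) * Q ^ (α - 2) * ⟪z, b i⟫ ^ 2 + 2 * α * Q ^ (α - 1)) * v y₀
      + 4 * α * Q ^ (α - 1) * ⟪z, b i⟫ * (Q⁻¹ * L (b i) - 2 * Q⁻¹ ^ 2 * ⟪z, b i⟫ * L z)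
      + Q ^ α * (Q⁻¹ ^ 2 * B (b i) (b i)
          - 2 * Q⁻¹ ^ 3 * ⟪z, b i⟫ * (B (b i) z + B z (b i))
          + 4 * Q⁻¹ ^ 4 * ⟪z, b i⟫ ^ 2 * B z z
          - 4 * Q⁻¹ ^ 2 * ⟪z, b i⟫ * L (b i)
          + (8 * Q⁻¹ ^ 3 * ⟪z, b i⟫ ^ 2 - 2 * Q⁻¹ ^ 2) * L z)) ?_ ?_
  · rw [main, laplacian_eq_sum_fderiv_fderiv b]
    have s1 : ∑ i, ⟪z, b i⟫ ^ 2 = Q := by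
      rw [hQ, ← b.sum_sq_norm_inner_left z]; simp
    have hz' : ∑ i, ⟪z, b i⟫ • b i = z := by
      simpa [real_inner_comm] using b.sum_repr' z
    have s2 : ∑ i, ⟪z, b i⟫ * L (b i) = L z := by
      conv_rhs => rw [← hz', map_sum]
      simp
    -- The two mixed sums are evaluated separately, so symmetry of the second derivative is not
    -- needed.
    have s3 : ∑ i, ⟪z, b i⟫ * B z (b i) = B z z := by
      conv_rhs => rw [← hz', map_sum]
      simp [hz']
    have s4 : ∑ i, ⟪z, b i⟫ * B (b i) z = B z z := by
      have : B z = ∑ i, ⟪z, b i⟫ • B (b i) := by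
        conv_lhs => rw [← hz', map_sum]
        simp
      rw [this]; simp
    have s5 : ∑ _i : Fin (Module.finrank ℝ E), (1 : ℝ) = Module.finrank ℝ E := by simp
    have p1 : Q ^ (α - 1) = Q ^ (α - 2) * Q := by
      rw [← Real.rpow_add_one hQ0.ne']; ring_nf
    have p2 : Q ^ α = Q ^ (α - 2) * Q ^ 2 := by
      rw [← Real.rpow_add_natCast hQ0.ne']; norm_num
    have p3 : (-1 - (Module.finrank ℝ E : ℝ) / 2) = α - 2 := by rw [hα]; ring
    rw [p3, p1, p2]
    trans (4 * α * (α - 1) * Q ^ (α - 2) * v y₀ * ∑ i, ⟪z, b i⟫ ^ 2)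
      + 2 * α * Q ^ (α - 2) * Q * v y₀ * (∑ _i : Fin (Module.finrank ℝ E), (1 : ℝ))
      + 4 * α * Q ^ (α - 2) * Q * (Q⁻¹ * (∑ i, ⟪z, b i⟫ * L (b i))
        - 2 * Q⁻¹ ^ 2 * L z * ∑ i, ⟪z, b i⟫ ^ 2)
      + Q ^ (α - 2) * Q ^ 2 * (Q⁻¹ ^ 2 * (∑ i, B (b i) (b i))
        - 2 * Q⁻¹ ^ 3 * (∑ i, ⟪z, b i⟫ * B (b i) z + ∑ i, ⟪z, b i⟫ * B z (b i))
        + 4 * Q⁻¹ ^ 4 * B z z * ∑ i, ⟪z, b i⟫ ^ 2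
        - 4 * Q⁻¹ ^ 2 * (∑ i, ⟪z, b i⟫ * L (b i))
        + (8 * Q⁻¹ ^ 3 * (∑ i, ⟪z, b i⟫ ^ 2)
          - 2 * Q⁻¹ ^ 2 * (∑ _i : Fin (Module.finrank ℝ E), (1 : ℝ))) * L z)
    · simp only [Finset.mul_sum, Finset.sum_mul, ← Finset.sum_add_distrib,
        ← Finset.sum_sub_distrib]
      refine Finset.sum_congr rfl fun i _ => ?_
      ring
    · rw [s1, s2, s3, s4, s5]
      -- With `n = 2 - 2α` the coefficients of `v y₀`, `L z` and `B z z` all vanish.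
      have hd : (Module.finrank ℝ E : ℝ) = 2 - 2 * α := by rw [hα]; ring
      rw [hd]
      field_simp
      ring
  · intro i
    filter_upwards [hqpos i] with t ht
    have h1 := (hrpow α i t ht).mul ((hv1 (y i t)).hasFDerivAt.comp_hasDerivAt t (hy i t ht))
    refine h1.congr_of_eventuallyEq (Eventually.of_forall fun t => ?_)
    simp only [kelvinTransform, hqnorm, ← hα]
    rfl
  · intro i
    have hQi : 0 < q i 0 := by rw [hq0]; exact hQ0
    have hq'd : HasDerivAt (q' i) 2 0 := by
      have := ((hasDerivAt_id (0 : ℝ)).const_mul 2).const_add (2 * ⟪z, b i⟫)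
      exact HasDerivAt.congr_deriv (f := q' i) this (by simp)
    have hy' := ((hqinv i 0 hQi).smul_const (b i)).sub
      ((((hqinv i 0 hQi).pow 2).mul hq'd).smul (hlin i 0))
    have hDv := ((hv2 (y i 0)).hasFDerivAt.comp_hasDerivAt 0 (hy i 0 hQi)).clm_apply hy'
    have hvv := (hv1 (y i 0)).hasFDerivAt.comp_hasDerivAt 0 (hy i 0 hQi)
    have h1 := (((hq'd.mul_const α).mul (hrpow (α - 1) i 0 hQi)).mul hvv).add
      ((hrpow α i 0 hQi).mul hDv)
    refine HasDerivAt.congr_deriv h1 ?_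
    have p1 : Q ^ (α - 1) = Q ^ (α - 2) * Q := by
      rw [← Real.rpow_add_one hQ0.ne']; ring_nf
    have p2 : Q ^ α = Q ^ (α - 2) * Q ^ 2 := by
      rw [← Real.rpow_add_natCast hQ0.ne']; norm_num
    have p3 : α - 1 - 1 = α - 2 := by ring
    have p4 : 2 - 1 = 1 := rfl
    simp only [Function.comp, hy0, y', hq0, hq'0, p1, p2, p3, p4, pow_one, ← hL, ← hB, Pi.pow_apply,
      Pi.mul_apply, Pi.sub_apply, Pi.smul_apply', zero_smul, add_zero, map_sub, map_smul, map_add,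
      smul_eq_mul,
      sub_apply, smul_apply]
    field_simp
    ring

/-! ### Minimum principles on annuli and punctured balls. -/

theorem isCompact_annulus {E : Type*} [NormedAddCommGroup E] [ProperSpace E] (ρ r : ℝ) :
    IsCompact {z : E | ρ ≤ ‖z‖ ∧ ‖z‖ ≤ r} := by
  have : {z : E | ρ ≤ ‖z‖ ∧ ‖z‖ ≤ r} = {z : E | ρ ≤ ‖z‖} ∩ Metric.closedBall 0 r := by
    ext z; simp
  rw [this]
  exact (isCompact_closedBall 0 r).inter_left (isClosed_le continuous_const continuous_norm)

open Topology in
theorem annulus_mem_nhds {E : Type*} [NormedAddCommGroup E] {ρ r : ℝ} {z : E}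
    (h1 : ρ < ‖z‖) (h2 : ‖z‖ < r) : {z : E | ρ ≤ ‖z‖ ∧ ‖z‖ ≤ r} ∈ 𝓝 z := by
  filter_upwards [continuous_norm.continuousAt.eventually (lt_mem_nhds h1),
    continuous_norm.continuousAt.eventually (gt_mem_nhds h2)] with w a b using ⟨a.le, b.le⟩

/-- A function on an annulus that is nonnegative on the boundary and negative somewhere attains
its minimum in the interior. -/
theorem exists_isMinOn_annulus {E : Type*} [NormedAddCommGroup E] [ProperSpace E]
    {h : E → ℝ} {ρ r : ℝ} (hc : ContinuousOn h {z : E | ρ ≤ ‖z‖ ∧ ‖z‖ ≤ r})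
    (hρ : ∀ z : E, ‖z‖ = ρ → 0 ≤ h z) (hr : ∀ z : E, ‖z‖ = r → 0 ≤ h z)
    {z₁ : E} (h1 : ρ ≤ ‖z₁‖) (h2 : ‖z₁‖ ≤ r) (hz₁ : h z₁ < 0) :
    ∃ z : E, ρ < ‖z‖ ∧ ‖z‖ < r ∧ h z < 0 ∧ IsLocalMin h z := by
  obtain ⟨z, hz, hmin⟩ := (isCompact_annulus ρ r).exists_isMinOn ⟨z₁, h1, h2⟩ hc
  have hz0 : h z < 0 := (hmin ⟨h1, h2⟩).trans_lt hz₁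
  have e1 : ρ < ‖z‖ := lt_of_le_of_ne hz.1 fun e => (hρ z e.symm).not_gt hz0
  have e2 : ‖z‖ < r := lt_of_le_of_ne hz.2 fun e => (hr z e).not_gt hz0
  exact ⟨z, e1, e2, hz0, hmin.isLocalMin (annulus_mem_nhds e1 e2)⟩

open Laplacian Topology in
/-- Maximum principle on an annulus in the presence of a positive strict supersolution `g`. -/
theorem nonneg_of_supersolution_annulus {E : Type*} [NormedAddCommGroup E]
    [InnerProductSpace ℝ E] [FiniteDimensional ℝ E] {D g : E → ℝ} {ρ r C : ℝ}
    (hD : ContinuousOn D {z : E | ρ ≤ ‖z‖ ∧ ‖z‖ ≤ r})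
    (hD2 : ∀ z : E, ρ < ‖z‖ → ‖z‖ < r → ContDiffAt ℝ 2 D z)
    (hg : ContDiff ℝ 2 g) (hg0 : ∀ z : E, ρ ≤ ‖z‖ → ‖z‖ ≤ r → 0 < g z)
    (hρ : ∀ z : E, ‖z‖ = ρ → 0 ≤ D z) (hr : ∀ z : E, ‖z‖ = r → 0 ≤ D z)
    (hΔD : ∀ z : E, ρ < ‖z‖ → ‖z‖ < r → D z < 0 → Δ D z ≤ -(C * D z))
    (hΔg : ∀ z : E, ρ < ‖z‖ → ‖z‖ < r → Δ g z < -(C * g z))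
    {z : E} (hz1 : ρ ≤ ‖z‖) (hz2 : ‖z‖ ≤ r) : 0 ≤ D z := by
  by_contra! hneg
  have hbd : ∀ w : E, ρ ≤ ‖w‖ → ‖w‖ ≤ r → (0 ≤ D w ↔ 0 ≤ D w / g w) := fun w h1 h2 => by
    rw [le_div_iff₀ (hg0 w h1 h2), zero_mul]
  have hρr := hz1.trans hz2
  obtain ⟨z₂, hz₂, hmin⟩ := (isCompact_annulus ρ r).exists_isMinOn ⟨z, hz1, hz2⟩
    (hD.div hg.continuous.continuousOn fun w hw => (hg0 w hw.1 hw.2).ne')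
  have hgz₂ := hg0 z₂ hz₂.1 hz₂.2
  set m := D z₂ / g z₂ with hm
  have hm0 : m < 0 := (hmin ⟨hz1, hz2⟩ : m ≤ D z / g z).trans_lt
    (div_neg_of_neg_of_pos hneg (hg0 z hz1 hz2))
  have hDz₂ : D z₂ = m * g z₂ := by rw [hm]; field_simp
  have hD0 : D z₂ < 0 := by rw [hDz₂]; exact mul_neg_of_neg_of_pos hm0 hgz₂
  have e1 : ρ < ‖z₂‖ := lt_of_le_of_ne hz₂.1 fun e => (hρ z₂ e.symm).not_gt hD0
  have e2 : ‖z₂‖ < r := lt_of_le_of_ne hz₂.2 fun e => (hr z₂ e).not_gt hD0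
  -- Since `m` is the minimum of `D / g`, the function `D - m g` is nonnegative and vanishes at
  -- `z₂`. The two differential inequalities make its Laplacian negative there.
  have hloc : IsLocalMin (D + (-m) • g) z₂ := by
    filter_upwards [annulus_mem_nhds e1 e2] with w hw
    have h1 : m ≤ D w / g w := hmin hw
    rw [le_div_iff₀ (hg0 w hw.1 hw.2)] at h1
    simp only [Pi.add_apply, Pi.smul_apply, smul_eq_mul]
    rw [hDz₂]
    linarith
  have hgc : ContDiffAt ℝ 2 g z₂ := hg.contDiffAt
  have hmg : ContDiffAt ℝ 2 ((-m) • g) z₂ := contDiffAt_const.smul hgc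
  have h0 := hloc.laplacian_nonneg ((hD2 z₂ e1 e2).add hmg)
  rw [(hD2 z₂ e1 e2).laplacian_add hmg, InnerProductSpace.laplacian_smul _ hgc, smul_eq_mul] at h0
  have h1 := hΔD z₂ e1 e2 hD0
  have h2 := mul_lt_mul_of_pos_left (hΔg z₂ e1 e2) (neg_pos.2 hm0)
  rw [hDz₂] at h1
  linarith

open Laplacian in
/-- Minimum principle on a punctured ball: point singularities are negligible for superharmonic
functions bounded from below. -/
theorem nonneg_of_superharmonic_punctured_ball {E : Type*} [NormedAddCommGroup E]
    [InnerProductSpace ℝ E] [FiniteDimensional ℝ E] (hdim : 3 ≤ Module.finrank ℝ E)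
    {h : E → ℝ} {r C : ℝ} (hc : ContinuousOn h {z : E | 0 < ‖z‖ ∧ ‖z‖ ≤ r})
    (hc2 : ∀ z : E, 0 < ‖z‖ → ‖z‖ < r → ContDiffAt ℝ 2 h z)
    (hΔ : ∀ z : E, 0 < ‖z‖ → ‖z‖ < r → Δ h z < 0)
    (hC : ∀ z : E, 0 < ‖z‖ → ‖z‖ ≤ r → -C ≤ h z)
    (hr : ∀ z : E, ‖z‖ = r → 0 ≤ h z) {z : E} (hz1 : 0 < ‖z‖) (hz2 : ‖z‖ ≤ r) : 0 ≤ h z := by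
  by_contra! hneg
  -- This is the fundamental solution `|z|^(2 - n)`, harmonic as the Kelvin transform of a constant.
  -- A small multiple of it absorbs the unknown behaviour at the origin.
  set Φ : E → ℝ := kelvinTransform fun _ => 1 with hΦ
  have hΦ2 : ∀ w : E, 0 < ‖w‖ → ContDiffAt ℝ 2 Φ w := fun w hw =>
    ContDiff.kelvinTransform contDiff_const (norm_pos_iff.1 hw)
  have hΦΔ : ∀ w : E, 0 < ‖w‖ → Δ Φ w = 0 := fun w hw => by
    rw [hΦ, laplacian_kelvinTransform contDiff_const (norm_pos_iff.1 hw)]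
    simp
  have hΦ0 : ∀ w : E, 0 < ‖w‖ → 0 < Φ w := fun w hw => by
    simp only [hΦ, kelvinTransform, mul_one]; positivity
  have hΦ1 : ∀ w : E, 0 < ‖w‖ → ‖w‖ ≤ 1 → ‖w‖⁻¹ ≤ Φ w := fun w hw hw1 => by
    simp only [hΦ, kelvinTransform, mul_one]
    have e : ‖w‖⁻¹ = (‖w‖ ^ 2) ^ (-(1 / 2) : ℝ) := by
      rw [← Real.rpow_natCast, ← Real.rpow_mul hw.le, ← Real.rpow_neg_one]; norm_num
    rw [e]
    apply Real.rpow_le_rpow_of_exponent_ge (by positivity) (pow_le_one₀ hw.le hw1)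
    have : (3 : ℝ) ≤ Module.finrank ℝ E := by exact_mod_cast hdim
    linarith
  -- Chosen so that `ε Φ` repairs only half of the deficit: `h + ε Φ` is still negative at `z`.
  set ε := -h z / (2 * Φ z) with hε
  have hΦz := hΦ0 z hz1
  have hε0 : 0 < ε := div_pos (by linarith) (by linarith)
  -- On the sphere of radius `ρ ≤ 1`, `ε Φ ≥ ε / ρ ≥ |C| + 1` outweighs the lower bound `-C` of `h`.
  set ρ := min (min (‖z‖ / 2) 1) (ε / (|C| + 1)) with hρ
  have hC1 : 0 < |C| + 1 := by positivity
  have hρ0 : 0 < ρ := by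
    rw [hρ]; exact lt_min (lt_min (by linarith) one_pos) (div_pos hε0 hC1)
  have hρ1 : ρ ≤ 1 := (min_le_left _ _).trans (min_le_right _ _)
  have hρz : ρ < ‖z‖ :=
    ((min_le_left _ _).trans (min_le_left _ _)).trans_lt (half_lt_self hz1)
  have hρC : |C| + 1 ≤ ε * ρ⁻¹ := by
    have : ρ ≤ ε / (|C| + 1) := min_le_right _ _
    rw [le_div_iff₀ hC1] at this
    rw [← div_eq_mul_inv, le_div_iff₀ hρ0]; linarith
  have hex : ∃ w : E, ρ < ‖w‖ ∧ ‖w‖ < r ∧ (h + ε • Φ) w < 0 ∧ IsLocalMin (h + ε • Φ) w := by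
    refine exists_isMinOn_annulus (z₁ := z) ?_ ?_ ?_ hρz.le hz2 ?_
    · refine (hc.mono fun w hw => ⟨hρ0.trans_le hw.1, hw.2⟩).add (continuousOn_const.smul ?_)
      exact fun w hw => (hΦ2 w (hρ0.trans_le hw.1)).continuousAt.continuousWithinAt
    · intro w hw
      have h1 := hC w (hw ▸ hρ0) (hw ▸ hρz.le.trans hz2)
      have h2 := hΦ1 w (hw ▸ hρ0) (hw ▸ hρ1)
      rw [hw] at h2
      have h3 := mul_le_mul_of_nonneg_left h2 hε0.le
      have h4 := le_abs_self C
      simp only [Pi.add_apply, Pi.smul_apply, smul_eq_mul]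
      linarith
    · intro w hw
      have h1 := hr w hw
      have h2 := mul_pos hε0 (hΦ0 w (hw ▸ hz1.trans_le hz2))
      simp only [Pi.add_apply, Pi.smul_apply, smul_eq_mul]
      linarith
    · have : ε * Φ z = -h z / 2 := by rw [hε]; field_simp
      simp only [Pi.add_apply, Pi.smul_apply, smul_eq_mul, this]
      linarith
  obtain ⟨w, hw1, hw2, -, hloc⟩ := hex
  have hw0 := hρ0.trans hw1
  have hεΦ : ContDiffAt ℝ 2 (ε • Φ) w := contDiffAt_const.smul (hΦ2 w hw0)
  have h0 := hloc.laplacian_nonneg ((hc2 w hw0 hw2).add hεΦ)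
  rw [(hc2 w hw0 hw2).laplacian_add hεΦ, InnerProductSpace.laplacian_smul _ (hΦ2 w hw0),
    hΦΔ w hw0] at h0
  exact (hΔ w hw0 hw2).not_ge (by simpa using h0)

/-! ### Laplacians of barriers and of compositions. -/

open Laplacian RealInnerProductSpace in
/-- The Laplacian of a quadratic polynomial in `‖z‖²`. -/
theorem laplacian_quadratic_norm_sq {E : Type*} [NormedAddCommGroup E]
    [InnerProductSpace ℝ E] [FiniteDimensional ℝ E] (A B C : ℝ) (z : E) :
    Δ (fun z : E => A + B * ‖z‖ ^ 2 + C * (‖z‖ ^ 2) ^ 2) z =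
      2 * Module.finrank ℝ E * B + C * (8 + 4 * Module.finrank ℝ E) * ‖z‖ ^ 2 := by
  set b := stdOrthonormalBasis ℝ E
  have hq2 : ContDiff ℝ 2 fun z : E => ‖z‖ ^ 2 := contDiff_norm_sq ℝ
  let q : _ → ℝ → ℝ := fun i t => ‖z‖ ^ 2 + 2 * t * ⟪z, b i⟫ + t ^ 2
  let q' : _ → ℝ → ℝ := fun i t => 2 * ⟪z, b i⟫ + 2 * t
  have hq : ∀ i t, HasDerivAt (q i) (q' i t) t := fun i t => by
    have := (((hasDerivAt_id t).const_mul 2).mul_const ⟪z, b i⟫).const_add (‖z‖ ^ 2) |>.add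
      ((hasDerivAt_id t).pow 2)
    refine HasDerivAt.congr_deriv (f := q i) this ?_
    simp [q']
  have hqnorm : ∀ i t, ‖z + t • b i‖ ^ 2 = q i t := fun i t => by
    rw [norm_add_sq_real, norm_smul, inner_smul_right, b.norm_eq_one i]
    simp [q]; ring
  have hq'd : ∀ i, HasDerivAt (q' i) 2 0 := fun i => by
    have := ((hasDerivAt_id (0 : ℝ)).const_mul 2).const_add (2 * ⟪z, b i⟫)
    exact HasDerivAt.congr_deriv (f := q' i) this (by simp)
  rw [laplacian_eq_sum_of_hasDerivAt_line b
    (g' := fun i t => B * q' i t + C * (2 * q i t * q' i t))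
    (g'' := fun i => 2 * B + C * (8 * ⟪z, b i⟫ ^ 2 + 4 * ‖z‖ ^ 2))
    (((contDiff_const.add (contDiff_const.mul hq2)).add
      (contDiff_const.mul (hq2.pow 2))).contDiffAt)]
  · have s1 : ∑ i, ⟪z, b i⟫ ^ 2 = ‖z‖ ^ 2 := by
      rw [← b.sum_sq_norm_inner_left z]; simp
    simp only [Finset.sum_add_distrib, ← Finset.mul_sum, s1]
    simp; ring
  · refine fun i => Filter.Eventually.of_forall fun t => ?_
    simp only [hqnorm]
    have := (((hq i t).const_mul B).const_add A).add (((hq i t).pow 2).const_mul C)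
    refine this.congr_deriv ?_
    simp
  · intro i
    have := ((hq'd i).const_mul B).add ((((hq i 0).const_mul 2).mul (hq'd i)).const_mul C)
    refine this.congr_deriv ?_
    simp [q, q']; ring

open Filter Topology Laplacian in
/-- Composition with a concave function of one variable decreases the Laplacian. -/
theorem laplacian_comp_le {E : Type*} [NormedAddCommGroup E]
    [InnerProductSpace ℝ E] [FiniteDimensional ℝ E] {f : E → ℝ} {x : E} {φ φ' : ℝ → ℝ} {φ'' : ℝ}
    (hf : ContDiffAt ℝ 2 f x) (hφ : ContDiffAt ℝ 2 φ (f x))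
    (h1 : ∀ᶠ s in 𝓝 (f x), HasDerivAt φ (φ' s) s) (h2 : HasDerivAt φ' φ'' (f x))
    (h3 : φ'' ≤ 0) : Δ (fun y => φ (f y)) x ≤ φ' (f x) * Δ f x := by
  set b := stdOrthonormalBasis ℝ E
  rw [laplacian_eq_sum_of_hasDerivAt_line b (f := fun y => φ (f y)) (hφ.comp x hf)
    (g' := fun i t => φ' (f (x + t • b i)) * fderiv ℝ f (x + t • b i) (b i))
    (g'' := fun i => φ'' * fderiv ℝ f x (b i) * fderiv ℝ f x (b i) +
      φ' (f x) * fderiv ℝ (fderiv ℝ f) x (b i) (b i)),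
    laplacian_eq_sum_fderiv_fderiv b, Finset.mul_sum]
  · refine Finset.sum_le_sum fun i _ => ?_
    have := mul_nonpos_of_nonpos_of_nonneg h3 (mul_self_nonneg (fderiv ℝ f x (b i)))
    linarith
  · intro i
    have hcont : Tendsto (fun t : ℝ => f (x + t • b i)) (𝓝 0) (𝓝 (f x)) := by
      have hl : Continuous (fun t : ℝ => x + t • b i) := by fun_prop
      exact hf.continuousAt.tendsto.comp (by simpa using hl.tendsto 0)
    filter_upwards [hf.eventually_hasDerivAt_line (b i), hcont.eventually h1] with t ht1 ht2
    exact ht2.comp t ht1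
  · intro i
    have e := (hf.eventually_hasDerivAt_line (b i)).self_of_nhds
    have h2' : HasDerivAt φ' φ'' (f (x + (0 : ℝ) • b i)) := by simpa using h2
    have := (h2'.comp (0 : ℝ) e).mul (hf.hasDerivAt_fderiv_line (b i))
    refine this.congr_deriv ?_
    simp

open Laplacian in
theorem laplacian_comp_smul_add {E : Type*} [NormedAddCommGroup E]
    [InnerProductSpace ℝ E] [FiniteDimensional ℝ E] {u : E → ℝ} (hu : ContDiff ℝ 2 u)
    (s : ℝ) (e z : E) :
    Δ (fun z => u (s • (e + z))) z = s ^ 2 * Δ u (s • (e + z)) := by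
  set b := stdOrthonormalBasis ℝ E
  have hu1 : Differentiable ℝ u := hu.differentiable (by norm_num)
  have hu2 : Differentiable ℝ (fderiv ℝ u) :=
    (hu.fderiv_right (m := 1) (by norm_num)).differentiable (by simp)
  have hl : ∀ i t, HasDerivAt (fun t : ℝ => s • (e + (z + t • b i))) (s • b i) t := fun i t => by
    refine HasDerivAt.congr_deriv (((((hasDerivAt_id t).smul_const (b i)).const_add z).const_add
      e).const_smul s) ?_
    simp
  rw [laplacian_eq_sum_of_hasDerivAt_line b
    (g' := fun i t => fderiv ℝ u (s • (e + (z + t • b i))) (s • b i))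
    (g'' := fun i => s ^ 2 * fderiv ℝ (fderiv ℝ u) (s • (e + z)) (b i) (b i)),
    laplacian_eq_sum_fderiv_fderiv b, Finset.mul_sum]
  · exact (hu.comp (contDiff_const.smul (contDiff_const.add contDiff_id))).contDiffAt
  · exact fun i => Filter.Eventually.of_forall fun t =>
      (hu1 _).hasFDerivAt.comp_hasDerivAt t (hl i t)
  · intro i
    have h3 : HasDerivAt (fun t : ℝ => fderiv ℝ u (s • (e + (z + t • b i))))
      (fderiv ℝ (fderiv ℝ u) (s • (e + (z + (0 : ℝ) • b i))) (s • b i)) 0 :=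
        (hu2 _).hasFDerivAt.comp_hasDerivAt (0 : ℝ) (hl i 0)
    refine HasDerivAt.congr_deriv
      ((ContinuousLinearMap.apply ℝ ℝ (s • b i)).hasFDerivAt.comp_hasDerivAt (0 : ℝ) h3) ?_
    simp; ring

open Laplacian in
theorem laplacian_log_one_add_norm_sq_le {E : Type*} [NormedAddCommGroup E]
    [InnerProductSpace ℝ E] [FiniteDimensional ℝ E] (x : E) :
    Δ (fun x : E => Real.log (1 + ‖x‖ ^ 2)) x ≤
      (1 + ‖x‖ ^ 2)⁻¹ * (2 * Module.finrank ℝ E) := by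
  have hpos : 0 < 1 + ‖x‖ ^ 2 := by positivity
  have hd : ∀ s : ℝ, 0 < 1 + s → HasDerivAt (fun s : ℝ => Real.log (1 + s)) (1 + s)⁻¹ s :=
    fun s hs => by
      simpa using ((hasDerivAt_id s).const_add 1).log hs.ne'
  have hlap : Δ (fun x : E => ‖x‖ ^ 2) x = 2 * Module.finrank ℝ E := by
    simpa using laplacian_quadratic_norm_sq 0 1 0 x
  have h2 : HasDerivAt (fun s : ℝ => (1 + s)⁻¹) (-1 / (1 + ‖x‖ ^ 2) ^ 2) (‖x‖ ^ 2) :=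
    ((hasDerivAt_id (‖x‖ ^ 2)).const_add 1).inv hpos.ne'
  rw [← hlap]
  refine laplacian_comp_le (φ := fun s => Real.log (1 + s)) (φ' := fun s => (1 + s)⁻¹)
    (contDiff_norm_sq ℝ).contDiffAt
    ((contDiffAt_const.add contDiffAt_id).log hpos.ne') ?_ h2
    (div_nonpos_of_nonpos_of_nonneg (by norm_num) (by positivity))
  filter_upwards [lt_mem_nhds (show -1 < ‖x‖ ^ 2 by linarith)] with s hs
  exact hd s (by linarith)

/-! ### Nonexistence for `0 ≤ p < 1`. -/

open Laplacian in
theorem not_isMatukumaSolution_of_lt_one {n : ℕ} {p : ℝ} (hp0 : 0 ≤ p) (hp1 : p < 1)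
    {u : EuclideanSpace ℝ (Fin n) → ℝ} (hu : IsMatukumaSolution n p u) : False := by
  set σ := 1 - p with hσ
  have hσ0 : 0 < σ := by linarith
  -- Makes `2 n ε < σ`, so the logarithm costs strictly less than `Δ (u ^ σ)` provides.
  set ε := σ / (2 * n + 1) with hε
  have hε0 : 0 < ε := by positivity
  set M := u 0 ^ σ + 1 with hM
  have hM0 : 0 < M := by have := Real.rpow_pos_of_pos (hu.pos 0) σ; linarith
  -- On `|x| = R` the term `ε log (1 + R²)` is at least `M`, whereas at the origin the sum `F + ε G
  -- - M` equals `-1`.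
  set R := Real.exp (M / ε) with hR
  let F : EuclideanSpace ℝ (Fin n) → ℝ := fun x => u x ^ σ
  let G : EuclideanSpace ℝ (Fin n) → ℝ := fun x => Real.log (1 + ‖x‖ ^ 2)
  let K : EuclideanSpace ℝ (Fin n) → ℝ := fun _ => -M
  have hF : ContDiff ℝ 2 F := hu.contDiff.rpow_const_of_ne fun x => (hu.pos x).ne'
  have hG : ContDiff ℝ 2 G :=
    (contDiff_const.add (contDiff_norm_sq ℝ)).log fun x => by positivity
  have hΔ : ∀ x, Δ (F + (ε • G + K)) x < 0 := fun x => by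
    have hpos : 0 < 1 + ‖x‖ ^ 2 := by positivity
    have hεG : ContDiff ℝ 2 (ε • G) := contDiff_const.smul hG
    have hc : ContDiff ℝ 2 K := contDiff_const
    have hGK : ContDiff ℝ 2 (ε • G + K) := hεG.add hc
    rw [hF.contDiffAt.laplacian_add hGK.contDiffAt,
      hεG.contDiffAt.laplacian_add hc.contDiffAt,
      InnerProductSpace.laplacian_smul _ hG.contDiffAt, show Δ K = 0 from InnerProductSpace.laplacian_const]
    have h1 : Δ F x ≤ σ * u x ^ (σ - 1) * Δ u x := by
      have hux := hu.pos x
      have hd : ∀ (β s : ℝ), 0 < s → HasDerivAt (fun s : ℝ => s ^ β) (β * s ^ (β - 1)) s :=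
        fun β s hs => Real.hasDerivAt_rpow_const (Or.inl hs.ne')
      refine laplacian_comp_le (φ := fun s => s ^ σ) (φ' := fun s => σ * s ^ (σ - 1))
        hu.contDiff.contDiffAt (Real.contDiffAt_rpow_const_of_ne hux.ne') ?_
        ((hd (σ - 1) (u x) hux).const_mul σ) ?_
      · filter_upwards [lt_mem_nhds hux] with s hs using hd σ s hs
      · have : 0 < u x ^ (σ - 1 - 1) := Real.rpow_pos_of_pos hux _
        -- Concavity of `s ^ σ`; this is where `0 ≤ p` enters.
        have h2 : σ - 1 ≤ 0 := by linarith
        exact mul_nonpos_of_nonneg_of_nonpos hσ0.le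
          (mul_nonpos_of_nonpos_of_nonneg h2 this.le)
    have h2 : Δ u x = -(1 / (1 + ‖x‖ ^ 2) * u x ^ p) := by rw [← hu.eq x, neg_neg]
    have h3 : u x ^ (σ - 1) * u x ^ p = 1 := by
      rw [← Real.rpow_add (hu.pos x), hσ]; simp
    have h4 : σ * u x ^ (σ - 1) * Δ u x = -((1 + ‖x‖ ^ 2)⁻¹ * σ) := by
      rw [h2]
      calc _ = -((1 + ‖x‖ ^ 2)⁻¹ * σ * (u x ^ (σ - 1) * u x ^ p)) := by ring
        _ = _ := by rw [h3, mul_one]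
    have h5 := laplacian_log_one_add_norm_sq_le x
    have h6 := mul_le_mul_of_nonneg_left h5 hε0.le
    have h7 : ε * (2 * n) < σ := by
      rw [hε, div_mul_eq_mul_div, div_lt_iff₀ (by positivity)]
      nlinarith
    have h8 := mul_lt_mul_of_pos_left h7 (inv_pos.2 hpos)
    simp only [finrank_euclideanSpace, Fintype.card_fin] at h6
    simp only [smul_eq_mul, Pi.zero_apply]
    change Δ F x + (ε * Δ G x + 0) < 0
    have h9 : ε * Δ G x ≤ (1 + ‖x‖ ^ 2)⁻¹ * (ε * (2 * n)) := by linarith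
    linarith
  have hex : ∃ w, -1 < ‖w‖ ∧ ‖w‖ < R ∧ (F + (ε • G + K)) w < 0 ∧
      IsLocalMin (F + (ε • G + K)) w := by
    -- Inner radius `-1` turns the annulus into a ball, with a vacuous inner boundary condition.
    refine exists_isMinOn_annulus (z₁ := 0)
      (hF.continuous.add ((hG.continuous.const_smul ε).add continuous_const)).continuousOn
      (fun z hz => by linarith [norm_nonneg z]) ?_ (by simp) (by simp [hR, Real.exp_nonneg])
      (by simp [F, G, K, hM])
    intro z hz
    have h1 : 0 < F z := Real.rpow_pos_of_pos (hu.pos z) σ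
    have hR0 : 0 < R := Real.exp_pos _
    have h2 : M / ε ≤ G z := by
      simp only [G, hz]
      rw [Real.le_log_iff_exp_le (by positivity), ← hR]
      nlinarith
    rw [div_le_iff₀ hε0] at h2
    simp only [K, Pi.add_apply, Pi.smul_apply, smul_eq_mul]
    linarith
  obtain ⟨w, -, -, -, hloc⟩ := hex
  exact (hΔ w).not_ge (hloc.laplacian_nonneg
    (hF.add ((contDiff_const.smul hG).add contDiff_const)).contDiffAt)

/-! ### Coordinates adapted to a sphere through the origin. -/

/-- The function `u` in coordinates that send the sphere of centre `s • e` and radius `s` to the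
unit sphere around the origin. -/
def rescale {E : Type*} [AddCommGroup E] [Module ℝ E] (u : E → ℝ) (e : E) (s : ℝ) (z : E) : ℝ :=
  u (s • (e + z))

/-- The weight of the Matukuma equation in the coordinates of `rescale`. -/
noncomputable def matukumaWeight {E : Type*} [NormedAddCommGroup E] (e : E) (s : ℝ) (z : E) : ℝ :=
  s ^ 2 / (1 + s ^ 2 * ‖e + z‖ ^ 2)

theorem matukumaWeight_pos {E : Type*} [NormedAddCommGroup E] (e : E) {s : ℝ} (hs : 0 < s)
    (z : E) : 0 < matukumaWeight e s z := by
  unfold matukumaWeight; positivity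

theorem matukumaWeight_le {E : Type*} [NormedAddCommGroup E] (e : E) (s : ℝ) (z : E) :
    matukumaWeight e s z ≤ s ^ 2 :=
  div_le_self (sq_nonneg s) (by nlinarith [mul_nonneg (sq_nonneg s) (sq_nonneg ‖e + z‖)])

theorem contDiff_rescale {E : Type*} [NormedAddCommGroup E] [NormedSpace ℝ E] {u : E → ℝ}
    (hu : ContDiff ℝ 2 u) (e : E) (s : ℝ) : ContDiff ℝ 2 (rescale u e s) :=
  hu.comp (contDiff_const.smul (contDiff_const.add contDiff_id))

theorem kelvinTransform_of_norm_eq_one {E : Type*} [NormedAddCommGroup E] [InnerProductSpace ℝ E]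
    (v : E → ℝ) {z : E} (hz : ‖z‖ = 1) : kelvinTransform v z = v z := by
  simp [kelvinTransform, hz]

theorem kelvinTransform_pos {E : Type*} [NormedAddCommGroup E] [InnerProductSpace ℝ E]
    {v : E → ℝ} (hv : ∀ z, 0 < v z) {z : E} (hz : 0 < ‖z‖) : 0 < kelvinTransform v z := by
  have := hv ((‖z‖ ^ 2)⁻¹ • z)
  unfold kelvinTransform; positivity

/-- Continuity jointly in the radius and the point, so that strict inequalities on compact annuli
away from the singularity persist for nearby radii. -/
theorem continuousAt_kelvinTransform_rescale {E : Type*} [NormedAddCommGroup E]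
    [InnerProductSpace ℝ E] {u : E → ℝ} (hu : Continuous u) (e : E) (s : ℝ) {z : E}
    (hz : 0 < ‖z‖) :
    ContinuousAt (fun a : ℝ × E => kelvinTransform (rescale u e a.1) a.2) (s, z) := by
  have hq : ContinuousAt (fun a : ℝ × E => ‖a.2‖ ^ 2) (s, z) := by fun_prop
  have hq0 : ‖z‖ ^ 2 ≠ 0 := by positivity
  refine (hq.rpow_const (Or.inl hq0)).mul (hu.continuousAt.comp ?_)
  exact continuousAt_fst.smul (continuousAt_const.add ((hq.inv₀ hq0).smul continuousAt_snd))

theorem continuous_rescale {E : Type*} [NormedAddCommGroup E] [NormedSpace ℝ E] {u : E → ℝ}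
    (hu : Continuous u) (e : E) : Continuous fun a : ℝ × E => rescale u e a.1 a.2 := by
  unfold rescale; fun_prop

/-- A bound for the difference of powers by the tangent line. -/
theorem Real.rpow_sub_rpow_le_of_one_le {a b p : ℝ} (ha : 0 ≤ a) (hb : 0 < b) (hp : 1 ≤ p) :
    b ^ p - a ^ p ≤ p * b ^ (p - 1) * (b - a) := by
  have h := one_add_mul_self_le_rpow_one_add (s := a / b - 1)
    (by linarith [div_nonneg ha hb.le]) hp
  have e1 : (1 + (a / b - 1)) ^ p = a ^ p / b ^ p := by
    rw [← Real.div_rpow ha hb.le]; ring_nf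
  have hbp : 0 < b ^ p := Real.rpow_pos_of_pos hb p
  rw [e1, le_div_iff₀ hbp] at h
  have e2 : b ^ p = b ^ (p - 1) * b := by
    rw [← Real.rpow_add_one hb.ne']; ring_nf
  have e3 : (1 + p * (a / b - 1)) * b ^ p = b ^ p + p * b ^ (p - 1) * (a - b) := by
    rw [e2]; field_simp
  rw [e3] at h
  linarith

/-! ### Comparison of a solution with its Kelvin transform. -/

section Matukuma

open Laplacian Topology Filter

variable {n : ℕ} {p : ℝ} {u : EuclideanSpace ℝ (Fin n) → ℝ}

theorem IsMatukumaSolution.laplacian_rescale (hu : IsMatukumaSolution n p u)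
    (e : EuclideanSpace ℝ (Fin n)) (s : ℝ) (z : EuclideanSpace ℝ (Fin n)) :
    Δ (rescale u e s) z = -(matukumaWeight e s z * rescale u e s z ^ p) := by
  have h := hu.eq (s • (e + z))
  have h2 := laplacian_comp_smul_add hu.contDiff s e z
  change Δ (fun z => u (s • (e + z))) z = _
  rw [h2, ← neg_neg (Δ u (s • (e + z))), h, norm_smul, mul_pow, Real.norm_eq_abs, sq_abs]
  simp only [matukumaWeight, rescale]
  ring

/-- With `q = |z|² < 1`, inversion turns the weight into `q s² / (q + s² |e + z|²)`, and replacing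
the `1` in the denominator by `q` is a strict gain. The powers of `q` left over compare in the right
direction exactly when `p ≤ n / (n - 2)`. -/
theorem IsMatukumaSolution.laplacian_kelvinTransform_lt (hu : IsMatukumaSolution n p u)
    (hn : 3 ≤ n) (hp : p ≤ (n : ℝ) / ((n : ℝ) - 2))
    (e : EuclideanSpace ℝ (Fin n)) {s : ℝ} (hs : 0 < s) {z : EuclideanSpace ℝ (Fin n)}
    (he : ‖e‖ = 1) (hz0 : 0 < ‖z‖) (hz1 : ‖z‖ < 1) :
    Δ (kelvinTransform (rescale u e s)) z <
      -(matukumaWeight e s z * kelvinTransform (rescale u e s) z ^ p) := by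
  rw [laplacian_kelvinTransform (contDiff_rescale hu.contDiff e s) (norm_pos_iff.1 hz0),
    hu.laplacian_rescale]
  simp only [kelvinTransform, finrank_euclideanSpace, Fintype.card_fin]
  set V := rescale u e s ((‖z‖ ^ 2)⁻¹ • z) with hV
  have hV0 : 0 < V := hu.pos _
  set q := ‖z‖ ^ 2 with hq
  have hq0 : 0 < q := by positivity
  have hq1 : q < 1 := pow_lt_one₀ hz0.le hz1 two_ne_zero
  have hn' : (3 : ℝ) ≤ n := by exact_mod_cast hn
  -- Here `‖e‖ = 1` is essential: the origin of the original coordinates lies on the inversion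
  -- sphere.
  have hnorm : ‖e + q⁻¹ • z‖ ^ 2 = ‖e + z‖ ^ 2 / q := by
    rw [norm_add_sq_real, norm_add_sq_real, inner_smul_right, norm_smul, he, mul_pow, ← hq,
      Real.norm_eq_abs, sq_abs]
    field_simp
    ring
  have hA : 0 ≤ s ^ 2 * ‖e + z‖ ^ 2 := by positivity
  have hexp : -((n : ℝ) / 2) ≤ (1 - (n : ℝ) / 2) * p := by
    rw [le_div_iff₀ (by linarith)] at hp
    linarith
  have h1 : q ^ ((1 - (n : ℝ) / 2) * p) ≤ q ^ (-1 - (n : ℝ) / 2) * q := by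
    rw [← Real.rpow_add_one hq0.ne']
    refine Real.rpow_le_rpow_of_exponent_ge hq0 hq1.le ?_
    linarith
  have h2 : matukumaWeight e s (q⁻¹ • z) = q * (s ^ 2 / (q + s ^ 2 * ‖e + z‖ ^ 2)) := by
    rw [matukumaWeight, hnorm]; field_simp
  have h3 : matukumaWeight e s z < s ^ 2 / (q + s ^ 2 * ‖e + z‖ ^ 2) := by
    rw [matukumaWeight]
    exact div_lt_div_of_pos_left (by positivity) (by positivity) (by linarith)
  have hVp : 0 < V ^ p := Real.rpow_pos_of_pos hV0 p
  have hQ : 0 < q ^ (-1 - (n : ℝ) / 2) * q := by positivity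
  have hw := matukumaWeight_pos e hs z
  rw [Real.mul_rpow (by positivity) hV0.le, ← Real.rpow_mul hq0.le, h2]
  have h4 : matukumaWeight e s z * (q ^ ((1 - (n : ℝ) / 2) * p) * V ^ p) <
      s ^ 2 / (q + s ^ 2 * ‖e + z‖ ^ 2) * ((q ^ (-1 - (n : ℝ) / 2) * q) * V ^ p) := by
    refine lt_of_le_of_lt (mul_le_mul_of_nonneg_left (mul_le_mul_of_nonneg_right h1 hVp.le) hw.le)
      (mul_lt_mul_of_pos_right h3 (by positivity))
  linarith

/-- Superharmonicity propagates a lower bound for the Kelvin transform from a sphere into the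
ball. -/
theorem IsMatukumaSolution.le_kelvinTransform_of_sphere (hu : IsMatukumaSolution n p u)
    (hn : 3 ≤ n) (hp : p ≤ (n : ℝ) / ((n : ℝ) - 2))
    {e : EuclideanSpace ℝ (Fin n)} {s : ℝ} (hs : 0 < s) (he : ‖e‖ = 1) {r m : ℝ} (hr : r ≤ 1)
    (hm : ∀ z, ‖z‖ = r → m ≤ kelvinTransform (rescale u e s) z)
    {z : EuclideanSpace ℝ (Fin n)} (hz0 : 0 < ‖z‖) (hz1 : ‖z‖ ≤ r) :
    m ≤ kelvinTransform (rescale u e s) z := by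
  set W := kelvinTransform (rescale u e s) with hW
  have hW2 : ∀ z, 0 < ‖z‖ → ContDiffAt ℝ 2 W z := fun z hz =>
    (contDiff_rescale hu.contDiff e s).kelvinTransform (norm_pos_iff.1 hz)
  have hW0 : ∀ z, 0 < ‖z‖ → 0 < W z := fun z hz => kelvinTransform_pos (fun _ => hu.pos _) hz
  let K : EuclideanSpace ℝ (Fin n) → ℝ := fun _ => m
  have hK : ContDiff ℝ 2 K := contDiff_const
  -- Positivity of `W` supplies the lower bound `-m` near the singularity.
  have := nonneg_of_superharmonic_punctured_ball (h := W - K) (r := r) (C := m) (by simpa using hn)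
    (fun w hw => ((hW2 w hw.1).sub hK.contDiffAt).continuousAt.continuousWithinAt)
    (fun w hw _ => (hW2 w hw).sub hK.contDiffAt) (fun w hw hw1 => ?_)
    (fun w hw _ => by have := hW0 w hw; simp only [Pi.sub_apply, K]; linarith)
    (fun w hw => by have := hm w hw; simp only [Pi.sub_apply, K]; linarith) hz0 hz1
  · simpa [K] using this
  · rw [(hW2 w hw).laplacian_sub hK.contDiffAt, show Δ K = 0 from InnerProductSpace.laplacian_const]
    have h1 := hu.laplacian_kelvinTransform_lt hn hp e hs he hw (hw1.trans_le hr)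
    have h2 := mul_pos (matukumaWeight_pos e hs w) (Real.rpow_pos_of_pos (hW0 w hw) p)
    simp only [Pi.zero_apply, sub_zero]
    linarith

/-- Maximum principle for the difference of the Kelvin transform and the function on an annulus
with a supersolution. -/
theorem IsMatukumaSolution.rescale_le_kelvinTransform_of_supersolution
    (hu : IsMatukumaSolution n p u)
    (hn : 3 ≤ n) (hp1 : 1 ≤ p) (hp : p ≤ (n : ℝ) / ((n : ℝ) - 2))
    {e : EuclideanSpace ℝ (Fin n)} {s : ℝ} (hs : 0 < s) (he : ‖e‖ = 1) {ρ M C : ℝ} (hρ : 0 < ρ)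
    (hM : ∀ z, ‖z‖ ≤ 1 → rescale u e s z ≤ M) (hC : s ^ 2 * (p * M ^ (p - 1)) ≤ C)
    {g : EuclideanSpace ℝ (Fin n) → ℝ} (hg : ContDiff ℝ 2 g)
    (hg0 : ∀ z, ρ ≤ ‖z‖ → ‖z‖ ≤ 1 → 0 < g z)
    (hΔg : ∀ z, ρ < ‖z‖ → ‖z‖ < 1 → Δ g z < -(C * g z))
    (hbd : ∀ z, ‖z‖ = ρ → rescale u e s z ≤ kelvinTransform (rescale u e s) z)
    {z : EuclideanSpace ℝ (Fin n)} (hz0 : ρ ≤ ‖z‖) (hz1 : ‖z‖ ≤ 1) :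
    rescale u e s z ≤ kelvinTransform (rescale u e s) z := by
  set V := rescale u e s with hV
  set W := kelvinTransform V with hW
  have hV2 : ContDiff ℝ 2 V := contDiff_rescale hu.contDiff e s
  have hW2 : ∀ z, 0 < ‖z‖ → ContDiffAt ℝ 2 W z := fun z hz =>
    hV2.kelvinTransform (norm_pos_iff.1 hz)
  have hW0 : ∀ z, 0 < ‖z‖ → 0 < W z := fun z hz => kelvinTransform_pos (fun _ => hu.pos _) hz
  have hV0 : ∀ z, 0 < V z := fun z => hu.pos _
  have := nonneg_of_supersolution_annulus (D := W - V) (ρ := ρ) (r := 1) (C := C)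
    (fun w hw => ((hW2 w (hρ.trans_le hw.1)).sub
      hV2.contDiffAt).continuousAt.continuousWithinAt)
    (fun w hw _ => (hW2 w (hρ.trans hw)).sub hV2.contDiffAt) hg hg0
    (fun w hw => sub_nonneg.2 (hbd w hw))
    (fun w hw => by
      simp only [Pi.sub_apply, hW, kelvinTransform_of_norm_eq_one V hw, sub_self, le_refl])
    (fun w hw hw1 hneg => ?_) hΔg hz0 hz1
  · exact sub_nonneg.1 this
  · have hw0 := hρ.trans hw
    rw [(hW2 w hw0).laplacian_sub hV2.contDiffAt]
    have h1 := hu.laplacian_kelvinTransform_lt hn hp e hs he hw0 hw1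
    have h2 := hu.laplacian_rescale e s w
    rw [← hV] at h1 h2
    rw [← hW] at h1
    have h3 := Real.rpow_sub_rpow_le_of_one_le (hW0 w hw0).le (hV0 w) hp1
    -- Where `W < V`, the tangent line at `V` bounds `V ^ p - W ^ p` linearly, and the exponent `p -
    -- 1 ≥ 0` lets the upper bound of `V` alone control the coefficient.
    have h4 : V w ^ (p - 1) ≤ M ^ (p - 1) :=
      Real.rpow_le_rpow (hV0 w).le (hM w hw1.le) (by linarith)
    have h5 : 0 < V w - W w := by simpa using hneg
    have h6 : matukumaWeight e s w * (p * V w ^ (p - 1)) ≤ C :=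
      (mul_le_mul (matukumaWeight_le e s w) (mul_le_mul_of_nonneg_left h4 (by linarith))
        (mul_nonneg (by linarith) (Real.rpow_nonneg (hV0 w).le _)) (sq_nonneg s)).trans hC
    have h7 := mul_le_mul_of_nonneg_left h3 (matukumaWeight_pos e hs w).le
    have h8 := mul_le_mul_of_nonneg_right h6 h5.le
    simp only [Pi.sub_apply]
    linarith

end Matukuma

/-! ### Moving the spheres: strictness, small radii, openness, all radii. -/

section Matukuma

open Laplacian Topology Filter

variable {n : ℕ} {p : ℝ} {u : EuclideanSpace ℝ (Fin n) → ℝ}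

/-- If the difference of the Kelvin transform and the function is nonnegative, it is superharmonic
in the punctured unit ball. -/
theorem IsMatukumaSolution.laplacian_kelvinTransform_sub_neg (hu : IsMatukumaSolution n p u)
    (hn : 3 ≤ n) (hp0 : 0 ≤ p) (hp : p ≤ (n : ℝ) / ((n : ℝ) - 2))
    {e : EuclideanSpace ℝ (Fin n)} {s : ℝ} (hs : 0 < s) (he : ‖e‖ = 1)
    {z : EuclideanSpace ℝ (Fin n)} (hz0 : 0 < ‖z‖) (hz1 : ‖z‖ < 1)
    (hle : rescale u e s z ≤ kelvinTransform (rescale u e s) z) :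
    Δ (kelvinTransform (rescale u e s) - rescale u e s) z < 0 := by
  have hV2 : ContDiff ℝ 2 (rescale u e s) := contDiff_rescale hu.contDiff e s
  rw [(hV2.kelvinTransform (norm_pos_iff.1 hz0)).laplacian_sub hV2.contDiffAt,
    hu.laplacian_rescale]
  have h1 := hu.laplacian_kelvinTransform_lt hn hp e hs he hz0 hz1
  have hV0 : 0 < rescale u e s z := hu.pos _
  have h2 := mul_le_mul_of_nonneg_left (Real.rpow_le_rpow hV0.le hle hp0)
    (matukumaWeight_pos e hs z).le
  linarith

/-- A contact point would be a local minimum of the difference, whose Laplacian is strictly negative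
there. -/
theorem IsMatukumaSolution.rescale_lt_kelvinTransform (hu : IsMatukumaSolution n p u)
    (hn : 3 ≤ n) (hp0 : 0 ≤ p) (hp : p ≤ (n : ℝ) / ((n : ℝ) - 2))
    {e : EuclideanSpace ℝ (Fin n)} {s : ℝ} (hs : 0 < s) (he : ‖e‖ = 1)
    (hle : ∀ z, 0 < ‖z‖ → ‖z‖ ≤ 1 → rescale u e s z ≤ kelvinTransform (rescale u e s) z)
    {z : EuclideanSpace ℝ (Fin n)} (hz0 : 0 < ‖z‖) (hz1 : ‖z‖ < 1) :
    rescale u e s z < kelvinTransform (rescale u e s) z := by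
  refine lt_of_le_of_ne (hle z hz0 hz1.le) fun heq => ?_
  have hV2 : ContDiff ℝ 2 (rescale u e s) := contDiff_rescale hu.contDiff e s
  have hmin : IsLocalMin (kelvinTransform (rescale u e s) - rescale u e s) z := by
    filter_upwards [continuous_norm.continuousAt.eventually (lt_mem_nhds hz0),
      continuous_norm.continuousAt.eventually (gt_mem_nhds hz1)] with w h1 h2
    have := hle w h1 h2.le
    simp only [Pi.sub_apply]
    linarith
  exact (hu.laplacian_kelvinTransform_sub_neg hn hp0 hp hs he hz0 hz1 heq.le).not_ge
    (hmin.laplacian_nonneg ((hV2.kelvinTransform (norm_pos_iff.1 hz0)).sub hV2.contDiffAt))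

/-- The comparison holds for small spheres. -/
theorem IsMatukumaSolution.eventually_rescale_le_kelvinTransform (hu : IsMatukumaSolution n p u)
    (hn : 3 ≤ n) (hp1 : 1 ≤ p) (hp : p ≤ (n : ℝ) / ((n : ℝ) - 2))
    {e : EuclideanSpace ℝ (Fin n)} (he : ‖e‖ = 1) :
    ∀ᶠ s in 𝓝[>] (0 : ℝ), ∀ z, 0 < ‖z‖ → ‖z‖ ≤ 1 →
      rescale u e s z ≤ kelvinTransform (rescale u e s) z := by
  have hu0 := hu.pos 0
  have hn' : (3 : ℝ) ≤ n := by exact_mod_cast hn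
  -- The prefactor of the Kelvin transform is at least `2` on `|z| = 1 / 2`, and `2 * (3 / 4) ≥ 5 /
  -- 4`. Inverted points there have norm `2`, so `|e + z| ≤ 3`, whence the requirement `s < δ / 3`.
  obtain ⟨δ, hδ, hball⟩ := Metric.eventually_nhds_iff_ball.1
    ((hu.contDiff.continuous.continuousAt (x := 0)).eventually
      (Ioo_mem_nhds (show 3 / 4 * u 0 < u 0 by linarith) (show u 0 < 5 / 4 * u 0 by linarith)))
  set M := 5 / 4 * u 0 with hM
  have hcont : ContinuousAt (fun s : ℝ => s ^ 2 * (p * M ^ (p - 1))) 0 := by fun_prop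
  filter_upwards [self_mem_nhdsWithin, nhdsWithin_le_nhds (gt_mem_nhds (show 0 < δ / 3 by linarith)),
    nhdsWithin_le_nhds (hcont.eventually (gt_mem_nhds
      (show (0 : ℝ) ^ 2 * (p * M ^ (p - 1)) < 1 by simp)))] with s hs hsδ hs1 z hz0 hz1
  replace hs : 0 < s := hs
  have hV : ∀ z, ‖z‖ ≤ 2 → 3 / 4 * u 0 < rescale u e s z ∧ rescale u e s z < M := fun z hz => by
    refine hball _ ?_
    rw [mem_ball_zero_iff, norm_smul, Real.norm_eq_abs, abs_of_pos hs]
    have : ‖e + z‖ ≤ 3 := (norm_add_le e z).trans (by linarith)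
    nlinarith
  have hW : ∀ z, ‖z‖ = 1 / 2 → M ≤ kelvinTransform (rescale u e s) z := fun z hz => by
    have h1 := (hV ((‖z‖ ^ 2)⁻¹ • z) (by
      rw [norm_smul, norm_inv, norm_pow, norm_norm, hz]; norm_num)).1
    have h2 : (2 : ℝ) ≤ (‖z‖ ^ 2) ^ (1 - (n : ℝ) / 2) := by
      have : (2 : ℝ) = (‖z‖ ^ 2) ^ (-(1 / 2) : ℝ) := by
        rw [← Real.rpow_natCast, ← Real.rpow_mul (norm_nonneg z), hz]
        norm_num [Real.rpow_neg_one]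
      refine this.trans_le (Real.rpow_le_rpow_of_exponent_ge (by rw [hz]; norm_num)
        (by rw [hz]; norm_num) ?_)
      linarith
    simp only [kelvinTransform, finrank_euclideanSpace, Fintype.card_fin]
    nlinarith
  have hsmall : ∀ z, 0 < ‖z‖ → ‖z‖ ≤ 1 / 2 →
      rescale u e s z ≤ kelvinTransform (rescale u e s) z := fun z h0 h1 =>
    (hV z (by linarith)).2.le.trans
      (hu.le_kelvinTransform_of_sphere hn hp hs he (by norm_num) hW h0 h1)
  rcases le_total ‖z‖ (1 / 2) with h | h
  · exact hsmall z hz0 h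
  · have hq2 : ContDiff ℝ 2 fun z : EuclideanSpace ℝ (Fin n) => ‖z‖ ^ 2 := contDiff_norm_sq ℝ
    -- The supersolution is `2 - |z|²`: its Laplacian is `-2n ≤ -6`, while its values are at most
    -- `2`.
    refine hu.rescale_le_kelvinTransform_of_supersolution hn hp1 hp hs he (ρ := 1 / 2) (M := M)
      (C := 1) (g := fun z => 2 + -1 * ‖z‖ ^ 2 + 0 * (‖z‖ ^ 2) ^ 2) (by norm_num)
      (fun w hw => (hV w (by linarith)).2.le) hs1.le
      ((contDiff_const.add (contDiff_const.mul hq2)).add (contDiff_const.mul (hq2.pow 2)))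
      (fun w _ hw => ?_) (fun w _ hw => ?_) (fun w hw => hsmall w (by rw [hw]; norm_num) hw.le)
      h hz1
    · nlinarith [norm_nonneg w]
    · rw [laplacian_quadratic_norm_sq]
      simp only [finrank_euclideanSpace, Fintype.card_fin]
      nlinarith [norm_nonneg w]

/-- The set of radii for which the comparison holds is open. -/
theorem IsMatukumaSolution.eventually_nhds_rescale_le_kelvinTransform
    (hu : IsMatukumaSolution n p u)
    (hn : 3 ≤ n) (hp1 : 1 ≤ p) (hp : p ≤ (n : ℝ) / ((n : ℝ) - 2))
    {e : EuclideanSpace ℝ (Fin n)} (he : ‖e‖ = 1) {s₀ : ℝ} (hs₀ : 0 < s₀)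
    (hle : ∀ z, 0 < ‖z‖ → ‖z‖ ≤ 1 → rescale u e s₀ z ≤ kelvinTransform (rescale u e s₀) z) :
    ∀ᶠ s in 𝓝 s₀, ∀ z, 0 < ‖z‖ → ‖z‖ ≤ 1 →
      rescale u e s z ≤ kelvinTransform (rescale u e s) z := by
  have huc := hu.contDiff.continuous
  have hp0 : 0 ≤ p := by linarith
  have hV2 : ContDiff ℝ 2 (rescale u e s₀) := contDiff_rescale hu.contDiff e s₀
  have hn' : (3 : ℝ) ≤ n := by exact_mod_cast hn
  have hlt := fun z => hu.rescale_lt_kelvinTransform (z := z) hn hp0 hp hs₀ he hle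
  set D := kelvinTransform (rescale u e s₀) - rescale u e s₀ with hD
  have hD2 : ∀ z, 0 < ‖z‖ → ContDiffAt ℝ 2 D z := fun z hz =>
    (hV2.kelvinTransform (norm_pos_iff.1 hz)).sub hV2.contDiffAt
  -- a positive lower bound near the singularity
  obtain ⟨δ, hδ, hδD⟩ : ∃ δ, 0 < δ ∧ ∀ z : EuclideanSpace ℝ (Fin n), 0 < ‖z‖ → ‖z‖ ≤ 1 / 2 →
      δ ≤ D z := by
    obtain ⟨δ, hδ, hsph⟩ := (isCompact_annulus (E := EuclideanSpace ℝ (Fin n)) (1 / 2)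
      (1 / 2)).exists_forall_le' (f := D) (a := 0)
      (fun z hz => (hD2 z (by linarith [hz.1])).continuousAt.continuousWithinAt)
      (fun z hz => sub_pos.2 (hlt z (by linarith [hz.1]) (by linarith [hz.2])))
    refine ⟨δ, hδ, fun z hz0 hz1 => ?_⟩
    let K : EuclideanSpace ℝ (Fin n) → ℝ := fun _ => δ
    have hK : ContDiff ℝ 2 K := contDiff_const
    have := nonneg_of_superharmonic_punctured_ball (h := D - K) (r := 1 / 2) (C := δ)
      (by simpa using hn)
      (fun w hw => ((hD2 w hw.1).sub hK.contDiffAt).continuousAt.continuousWithinAt)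
      (fun w hw _ => (hD2 w hw).sub hK.contDiffAt) (fun w hw hw1 => ?_)
      (fun w hw hw1 => by
        have := hle w hw (by linarith)
        simp only [Pi.sub_apply, hD, K]; linarith)
      (fun w hw => by
        have := hsph w ⟨hw.ge, hw.le⟩
        simp only [Pi.sub_apply, K]; linarith) hz0 hz1
    · simpa [K] using this
    · rw [(hD2 w hw).laplacian_sub hK.contDiffAt,
        show Δ K = 0 from InnerProductSpace.laplacian_const]
      simpa using hu.laplacian_kelvinTransform_sub_neg hn hp0 hp hs₀ he hw (by linarith)
        (hle w hw (by linarith))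
  -- separation of the two functions by a constant in a small ball
  obtain ⟨r', hr', hVr⟩ := Metric.eventually_nhds_iff_ball.1
    ((hV2.continuous.continuousAt (x := 0)).eventually
      (Ioo_mem_nhds (show rescale u e s₀ 0 - δ / 3 < rescale u e s₀ 0 by linarith)
        (show rescale u e s₀ 0 < rescale u e s₀ 0 + δ / 3 by linarith)))
  -- At `s₀` the constant `m` separates `V < V 0 + δ / 3` on the small ball from `W > V 0 + 2δ / 3`
  -- on its boundary sphere. For nearby `s`, superharmonicity carries `m ≤ W` to the singularity,
  -- where compactness is unavailable.
  set m := rescale u e s₀ 0 + δ / 2 with hm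
  set r := min (r' / 2) (1 / 2) with hr
  have hr0 : 0 < r := lt_min (by linarith) (by norm_num)
  have hr2 : r ≤ 1 / 2 := min_le_right _ _
  have hrr : r < r' := (min_le_left _ _).trans_lt (by linarith)
  have hcV : ∀ z, ContinuousAt (fun a : ℝ × EuclideanSpace ℝ (Fin n) => rescale u e a.1 a.2)
      (s₀, z) := fun z => (continuous_rescale huc e).continuousAt
  have hcW : ∀ z, 0 < ‖z‖ → ContinuousAt (fun a : ℝ × EuclideanSpace ℝ (Fin n) =>
      kelvinTransform (rescale u e a.1) a.2) (s₀, z) := fun z hz =>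
    continuousAt_kelvinTransform_rescale huc e s₀ hz
  have ev1 : ∀ᶠ s in 𝓝 s₀, ∀ z ∈ {z : EuclideanSpace ℝ (Fin n) | r ≤ ‖z‖ ∧ ‖z‖ ≤ r},
      m < kelvinTransform (rescale u e s) z := by
    refine (isCompact_annulus r r).eventually_forall_of_forall_eventually fun z hz => ?_
    have hz0 : 0 < ‖z‖ := hr0.trans_le hz.1
    refine (hcW z hz0).eventually (lt_mem_nhds ?_)
    have h1 := hδD z hz0 (hz.2.trans hr2)
    have h2 := (hVr z (by simpa using hz.2.trans_lt hrr)).1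
    simp only [hD, Pi.sub_apply] at h1
    simp only
    linarith
  have ev2 : ∀ᶠ s in 𝓝 s₀, ∀ z ∈ {z : EuclideanSpace ℝ (Fin n) | 0 ≤ ‖z‖ ∧ ‖z‖ ≤ r},
      rescale u e s z < m := by
    refine (isCompact_annulus 0 r).eventually_forall_of_forall_eventually fun z hz => ?_
    refine (hcV z).eventually (gt_mem_nhds ?_)
    have h2 := (hVr z (by simpa using hz.2.trans_lt hrr)).2
    simp only
    linarith
  -- a uniform upper bound
  obtain ⟨M, hM⟩ : ∃ M, ∀ z ∈ {z : EuclideanSpace ℝ (Fin n) | 0 ≤ ‖z‖ ∧ ‖z‖ ≤ 1},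
      rescale u e s₀ z < M := by
    obtain ⟨M, hM⟩ := ((isCompact_annulus 0 1).image hV2.continuous).bddAbove
    exact ⟨M + 1, fun z hz => by linarith [hM (Set.mem_image_of_mem _ hz)]⟩
  have ev3 : ∀ᶠ s in 𝓝 s₀, ∀ z ∈ {z : EuclideanSpace ℝ (Fin n) | 0 ≤ ‖z‖ ∧ ‖z‖ ≤ 1},
      rescale u e s z < M :=
    (isCompact_annulus 0 1).eventually_forall_of_forall_eventually fun z hz =>
      (hcV z).eventually (gt_mem_nhds (hM z hz))
  have hM0 : 0 < M := (hu.pos _).trans (hM 0 (by simp))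
  set C := (s₀ + 1) ^ 2 * (p * M ^ (p - 1)) with hC
  have hMp : 0 < p * M ^ (p - 1) := mul_pos (by linarith) (Real.rpow_pos_of_pos hM0 _)
  have hC0 : 0 < C := by positivity
  -- a thin shell
  obtain ⟨ρ, hρ2, hρ1, hρa, hρb⟩ : ∃ ρ : ℝ, 1 / 2 < ρ ∧ ρ < 1 ∧ 4 * n + 1 < (8 + 4 * n) * ρ ^ 2 ∧
      C * (1 - ρ ^ 2) ^ 2 < 1 := by
    have c1 : ContinuousAt (fun ρ : ℝ => (8 + 4 * n) * ρ ^ 2) 1 := by fun_prop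
    have c2 : ContinuousAt (fun ρ : ℝ => C * (1 - ρ ^ 2) ^ 2) 1 := by fun_prop
    have hn1 : 4 * (n : ℝ) + 1 < (8 + 4 * n) * 1 ^ 2 := by linarith
    have hC1 : C * (1 - (1 : ℝ) ^ 2) ^ 2 < 1 := by simp
    have h12 : (1 / 2 : ℝ) < 1 := by norm_num
    have := (((eventually_gt_nhds h12).and ((c1.eventually_const_lt hn1).and
      (c2.eventually_lt_const hC1))).filter_mono nhdsWithin_le_nhds).and
      (self_mem_nhdsWithin (s := Set.Iio (1 : ℝ)) (a := 1)) |>.exists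
    obtain ⟨ρ, ⟨h1, h3, h4⟩, h2⟩ := this
    exact ⟨ρ, h1, h2, h3, h4⟩
  have ev4 : ∀ᶠ s in 𝓝 s₀, ∀ z ∈ {z : EuclideanSpace ℝ (Fin n) | r ≤ ‖z‖ ∧ ‖z‖ ≤ ρ},
      rescale u e s z < kelvinTransform (rescale u e s) z := by
    refine (isCompact_annulus r ρ).eventually_forall_of_forall_eventually fun z hz => ?_
    have hz0 : 0 < ‖z‖ := hr0.trans_le hz.1
    exact (hcV z).eventually_lt (hcW z hz0) (hlt z hz0 (hz.2.trans_lt hρ1))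
  filter_upwards [ev1, ev2, ev3, ev4, lt_mem_nhds hs₀, gt_mem_nhds (show s₀ < s₀ + 1 by linarith)]
    with s h1 h2 h3 h4 hs hs1 z hz0 hz1
  rcases le_total ‖z‖ r with h | h
  · exact (h2 z ⟨hz0.le, h⟩).le.trans (hu.le_kelvinTransform_of_sphere hn hp hs he (by linarith)
      (fun w hw => (h1 w ⟨hw.ge, hw.le⟩).le) hz0 h)
  rcases le_total ‖z‖ ρ with h' | h'
  · exact (h4 z ⟨h, h'⟩).le
  · have hq2 : ContDiff ℝ 2 fun z : EuclideanSpace ℝ (Fin n) => ‖z‖ ^ 2 := contDiff_norm_sq ℝ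
    have hsq : ∀ w : EuclideanSpace ℝ (Fin n), ρ ≤ ‖w‖ → ‖w‖ ≤ 1 →
        ρ ^ 2 ≤ ‖w‖ ^ 2 ∧ ‖w‖ ^ 2 ≤ 1 := fun w hw hw1 =>
      ⟨by gcongr, pow_le_one₀ (norm_nonneg w) hw1⟩
    -- The supersolution is `1 - C (1 - |z|²)²`. Its Laplacian is `C (4n - (8 + 4n) |z|²)`, which is
    -- less than `-C` in the shell by the choice of `ρ`; the other condition on `ρ` keeps it
    -- positive.
    refine hu.rescale_le_kelvinTransform_of_supersolution hn hp1 hp hs he (ρ := ρ) (M := M)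
      (C := C) (g := fun z => (1 - C) + (2 * C) * ‖z‖ ^ 2 + (-C) * (‖z‖ ^ 2) ^ 2) (by linarith)
      (fun w hw => (h3 w ⟨norm_nonneg w, hw⟩).le) ?_
      ((contDiff_const.add (contDiff_const.mul hq2)).add (contDiff_const.mul (hq2.pow 2)))
      (fun w hw hw1 => ?_) (fun w hw hw1 => ?_) (fun w hw => (h4 w ⟨?_, hw.le⟩).le)
      h' hz1
    · rw [hC]; gcongr
    · obtain ⟨ha, hb⟩ := hsq w hw hw1
      have : (1 - ‖w‖ ^ 2) ^ 2 ≤ (1 - ρ ^ 2) ^ 2 :=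
        pow_le_pow_left₀ (by linarith) (by linarith) 2
      have := mul_le_mul_of_nonneg_left this hC0.le
      linarith
    · obtain ⟨ha, hb⟩ := hsq w hw.le hw1.le
      rw [laplacian_quadratic_norm_sq]
      simp only [finrank_euclideanSpace, Fintype.card_fin]
      have h5 : (8 + 4 * (n : ℝ)) * ρ ^ 2 ≤ (8 + 4 * n) * ‖w‖ ^ 2 := by gcongr
      have h6 : 0 < C * ((8 + 4 * n) * ‖w‖ ^ 2 - (4 * n + 1)) := mul_pos hC0 (by linarith)
      have h7 : 0 ≤ C * (C * (1 - ‖w‖ ^ 2) ^ 2) := by positivity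
      linarith
    · linarith

/-- The comparison holds for all spheres through the origin. -/
theorem IsMatukumaSolution.rescale_le_kelvinTransform (hu : IsMatukumaSolution n p u)
    (hn : 3 ≤ n) (hp1 : 1 ≤ p) (hp : p ≤ (n : ℝ) / ((n : ℝ) - 2))
    {e : EuclideanSpace ℝ (Fin n)} (he : ‖e‖ = 1) {s : ℝ} (hs : 0 < s)
    {z : EuclideanSpace ℝ (Fin n)} (hz0 : 0 < ‖z‖) (hz1 : ‖z‖ ≤ 1) :
    rescale u e s z ≤ kelvinTransform (rescale u e s) z := by
  have huc := hu.contDiff.continuous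
  let S : Set ℝ := {s | ∀ z, 0 < ‖z‖ → ‖z‖ ≤ 1 →
    rescale u e s z ≤ kelvinTransform (rescale u e s) z}
  obtain ⟨s₁, hs₁S, hs₁0, hs₁s⟩ : ∃ s₁, s₁ ∈ S ∧ 0 < s₁ ∧ s₁ ≤ s := by
    obtain ⟨s₁, ⟨h1, h2⟩, h3⟩ := (((hu.eventually_rescale_le_kelvinTransform hn hp1 hp he).and
      (self_mem_nhdsWithin (s := Set.Ioi (0 : ℝ)))).and
      ((eventually_lt_nhds hs).filter_mono nhdsWithin_le_nhds)).exists
    exact ⟨s₁, h1, h2, h3.le⟩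
  have hclosed : IsClosed S := by
    have : S = ⋂ z ∈ {z : EuclideanSpace ℝ (Fin n) | 0 < ‖z‖ ∧ ‖z‖ ≤ 1},
        {s | rescale u e s z ≤ kelvinTransform (rescale u e s) z} := by
      ext s; simp [S]
    rw [this]
    refine isClosed_biInter fun z hz => isClosed_le ?_ ?_
    · exact (continuous_rescale huc e).comp (continuous_id.prodMk continuous_const)
    · exact continuous_iff_continuousAt.2 fun t =>
        ContinuousAt.comp (f := fun t => (t, z)) (x := t)
          (continuousAt_kelvinTransform_rescale huc e t hz.1) (by fun_prop)
  -- Continuation along `[s₁, s]`: the admissible set is closed and can always be extended to the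
  -- right.
  refine IsClosed.Icc_subset_of_forall_exists_gt (hclosed.inter isClosed_Icc) hs₁S
    (fun t ht y hy => ?_) ⟨hs₁s, le_rfl⟩ z hz0 hz1
  have h1 := hu.eventually_nhds_rescale_le_kelvinTransform hn hp1 hp he
    (hs₁0.trans_le ht.2.1) ht.1
  obtain ⟨t', h2, h3⟩ := ((h1.filter_mono nhdsWithin_le_nhds).and (Ioc_mem_nhdsGT hy)).exists
  exact ⟨t', h2, h3⟩

end Matukuma

/-! ### From spheres to hyperplanes: reflection and radial symmetry. -/

open Filter Topology RealInnerProductSpace in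
/-- A solution does not decrease under reflection of a half-space towards the other one through
a hyperplane containing the origin. -/
theorem IsMatukumaSolution.le_reflection {n : ℕ} {p : ℝ} {u : EuclideanSpace ℝ (Fin n) → ℝ}
    (hu : IsMatukumaSolution n p u)
    (hn : 3 ≤ n) (hp1 : 1 ≤ p) (hp : p ≤ (n : ℝ) / ((n : ℝ) - 2))
    {e x : EuclideanSpace ℝ (Fin n)} (he : ‖e‖ = 1) (hx : 0 < ⟪x, e⟫) :
    u x ≤ u (x - (2 * ⟪x, e⟫) • e) := by
  set c := ⟪x, e⟫ with hc
  -- Here `t = 1 / s` and `z = t x - e` represents the fixed point `x`, with `q t = |z|²`. Since `c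
  -- > 0`, `x` is in the ball for small `t > 0`; as `t → 0`, `q t → 1` and the inverted point tends
  -- to `x - 2 c e`.
  let q : ℝ → ℝ := fun t => 1 - 2 * c * t + ‖x‖ ^ 2 * t ^ 2
  have hqc : Continuous q := by fun_prop
  have hnorm : ∀ t, ‖t • x - e‖ ^ 2 = q t := fun t => by
    rw [norm_sub_sq_real, real_inner_smul_left, ← hc, norm_smul, he, mul_pow, Real.norm_eq_abs,
      sq_abs]
    simp only [q]; ring
  have hq0 : q 0 = 1 := by simp [q]
  have hqpos : ∀ᶠ t in 𝓝[>] (0 : ℝ), 0 < q t :=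
    (hqc.continuousAt.eventually_const_lt (by rw [hq0]; exact one_pos)).filter_mono
      nhdsWithin_le_nhds
  have hqle : ∀ᶠ t in 𝓝[>] (0 : ℝ), q t ≤ 1 := by
    have hcont : Continuous fun t : ℝ => ‖x‖ ^ 2 * t := by fun_prop
    have h0 : ‖x‖ ^ 2 * 0 < 2 * c := by linarith
    filter_upwards [self_mem_nhdsWithin,
      ((hcont.tendsto 0).eventually_lt_const h0).filter_mono nhdsWithin_le_nhds] with t ht h
    have := mul_pos (show (0 : ℝ) < t from ht) (sub_pos.2 h)
    simp only [q]; linarith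
  have hev : ∀ᶠ t in 𝓝[>] (0 : ℝ), u x ≤ q t ^ (1 - (n : ℝ) / 2) *
      u ((q t)⁻¹ • x + ((q t)⁻¹ * (‖x‖ ^ 2 * t - 2 * c)) • e) := by
    filter_upwards [self_mem_nhdsWithin, hqpos, hqle] with t ht h0 h1
    replace ht : 0 < t := ht
    have hz0 : 0 < ‖t • x - e‖ := by
      rw [← hnorm] at h0; exact (sq_pos_iff.1 h0).symm.lt_of_le (norm_nonneg _)
    have hz1 : ‖t • x - e‖ ≤ 1 := by
      rw [← hnorm] at h1; exact (sq_le_one_iff₀ hz0.le).1 h1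
    have h := hu.rescale_le_kelvinTransform hn hp1 hp he (inv_pos.2 ht) hz0 hz1
    simp only [rescale, kelvinTransform, hnorm, finrank_euclideanSpace, Fintype.card_fin] at h
    have e1 : t⁻¹ • (e + (t • x - e)) = x := by
      rw [add_sub_cancel, inv_smul_smul₀ ht.ne']
    have e2 : t⁻¹ • (e + (q t)⁻¹ • (t • x - e)) =
        (q t)⁻¹ • x + ((q t)⁻¹ * (‖x‖ ^ 2 * t - 2 * c)) • e := by
      have e3 : (q t)⁻¹ * (‖x‖ ^ 2 * t - 2 * c) = t⁻¹ * (1 - (q t)⁻¹) := by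
        field_simp
        simp only [q]; ring
      rw [e3]
      simp only [smul_add, smul_sub, smul_smul, mul_sub, sub_smul, mul_one]
      rw [show t⁻¹ * ((q t)⁻¹ * t) = (q t)⁻¹ by field_simp]
      abel
    rwa [e1, e2] at h
  have hlim : Tendsto (fun t => q t ^ (1 - (n : ℝ) / 2) *
      u ((q t)⁻¹ • x + ((q t)⁻¹ * (‖x‖ ^ 2 * t - 2 * c)) • e)) (𝓝[>] 0)
      (𝓝 (u (x - (2 * c) • e))) := by
    have hca : ContinuousAt (fun t => q t ^ (1 - (n : ℝ) / 2) *
        u ((q t)⁻¹ • x + ((q t)⁻¹ * (‖x‖ ^ 2 * t - 2 * c)) • e)) 0 := by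
      have hq1 : q 0 ≠ 0 := by rw [hq0]; exact one_ne_zero
      have hinv : ContinuousAt (fun t => (q t)⁻¹) 0 := hqc.continuousAt.inv₀ hq1
      refine (hqc.continuousAt.rpow_const (Or.inl hq1)).mul
        (hu.contDiff.continuous.continuousAt.comp ?_)
      exact (hinv.smul continuousAt_const).add
        ((hinv.mul (by fun_prop)).smul continuousAt_const)
    have := hca.tendsto
    simp only [hq0] at this
    refine (this.mono_left nhdsWithin_le_nhds).trans_eq ?_
    simp [sub_eq_add_neg]
  exact ge_of_tendsto hlim hev

open RealInnerProductSpace in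
-- For distinct `x`, `y` of equal norm, reflection along `e = (x - y) / |x - y|` sends `x` to `y`,
-- and `⟪x, e⟫ = |x - y| / 2 > 0`. Exchanging `x` and `y` gives the reverse inequality.
theorem IsMatukumaSolution.isRadiallySymmetric {n : ℕ} {p : ℝ}
    {u : EuclideanSpace ℝ (Fin n) → ℝ} (hu : IsMatukumaSolution n p u)
    (hn : 3 ≤ n) (hp1 : 1 ≤ p) (hp : p ≤ (n : ℝ) / ((n : ℝ) - 2)) : IsRadiallySymmetric u := by
  have key : ∀ x y : EuclideanSpace ℝ (Fin n), ‖x‖ = ‖y‖ → u x ≤ u y := by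
    intro x y hxy
    rcases eq_or_ne x y with rfl | hne
    · exact le_rfl
    set d := ‖x - y‖ with hd
    have hd0 : 0 < d := norm_pos_iff.2 (sub_ne_zero.2 hne)
    have hdsq : d ^ 2 = 2 * ⟪x, x - y⟫ := by
      rw [hd, norm_sub_sq_real, inner_sub_right, real_inner_self_eq_norm_sq, ← hxy]; ring
    have hinner : ⟪x, d⁻¹ • (x - y)⟫ = d / 2 := by
      rw [real_inner_smul_right, show ⟪x, x - y⟫ = d ^ 2 / 2 by linarith]
      field_simp
    have h := hu.le_reflection hn hp1 hp (e := d⁻¹ • (x - y)) (x := x)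
      (by rw [norm_smul, norm_inv, Real.norm_eq_abs, abs_of_pos hd0, ← hd, inv_mul_cancel₀ hd0.ne'])
      (by rw [hinner]; positivity)
    rwa [hinner, smul_smul, show 2 * (d / 2) * d⁻¹ = 1 by field_simp, one_smul,
      sub_sub_cancel] at h
  exact fun x y hxy => le_antisymm (key x y hxy) (key y x hxy.symm)

theorem corollary1p1 (n : ℕ) (hn : 3 ≤ n) (p : ℝ) :
    ((1 ≤ p ∧ p ≤ (n : ℝ) / ((n : ℝ) - 2)) →
      ∀ u : EuclideanSpace ℝ (Fin n) → ℝ, IsMatukumaSolution n p u → IsRadiallySymmetric u) ∧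
    ((0 ≤ p ∧ p < 1) →
      ¬ ∃ u : EuclideanSpace ℝ (Fin n) → ℝ, IsMatukumaSolution n p u) :=
  ⟨fun hp _ hu => hu.isRadiallySymmetric hn hp.1 hp.2,
    fun hp ⟨_, hu⟩ => not_isMatukumaSolution_of_lt_one hp.1 hp.2 hu⟩
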